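/- Let $0<p<\tfrac12$. Write $|J|$ for arc length on the unit circle $\partial\mathbb D$ (total length $2\pi$). For real $\alpha$, an $\alpha$-Beurling--Carleson set is a closed set $E\subset\partial\mathbb D$ of zero length whose complementary arcs $\{J\}$ (the connected components of $\partial\mathbb D\setminus E$) satisfy $\sum_J|J|^{\alpha}<\infty$. For a finite positive measure $\mu$ on $\partial\mathbb D$ put $$S_\mu(z)=\exp\Bigl(-\int_{\partial\mathbb D}\frac{\zeta+z}{\zeta-z}\,d\mu(\zeta)\Bigr),\qquad |z|<1,$$ and let $H^p$ be the space of analytic functions $f$ on the unit disk with $\sup_{0\le r<1}\int_{-\pi}^{\pi}|f(re^{i\theta})|^p\,d\theta<\infty$. For $A>2$, let $E_A\subset\partial\mathbb D$ be the standard Cantor set: start with the arc $\{e^{it}:0\le t\le 1\}$ of length $1$ and replace repeatedly each arc of generation $n$, of length $A^{-n}$, by its two end pieces of length $A^{-n-1}$; $E_A$ is the intersection over $n$ of the unions of the $2^n$ closed arcs of generation $n$. The Cantor measure on $E_A$ is the probability measure supported on $E_A$ that gives mass $2^{-n}$ to each arc of generation $n$. Then: (a) For every real $q<\frac{p}{1-p}$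 there is an $A>2$ such that $E=E_A$ is a $(1-q)$-Beurling--Carleson set and, $\mu$ being the Cantor measure on $E$, one has $S_\nu'\notin H^p$ for every measure $\nu$ with $0<\nu\le\mu$ (i.e. $\nu\neq0$ and $\nu\le\mu$). (b) There is a finite positive singular measure $\mu$ on $\partial\mathbb D$ that is concentrated on a countable union of $(1-p)$-Beurling--Carleson sets but cannot be written as a countable sum $\mu=\sum_k\mu_k$ of finite positive measures $\mu_k$ with $S_{\mu_k}'\in H^p$ for all $k$. (c) If $q$ is a real number such that $S_\mu'\in H^p$ for every $(1-q)$-Beurling--Carleson set $E$ and every finite positive measure $\mu$ supported on $E$, then $q\ge\frac{p}{1-p}$. -/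

import Mathlib

open MeasureTheory Set
open scoped ENNReal NNReal

noncomputable section

instance instMeasurableSpaceCircle : MeasurableSpace Circle := borel Circle

instance instBorelSpaceCircle : BorelSpace Circle := ⟨rfl⟩

/-- Arc length on the unit circle (total mass `2 * π`). -/
def arcLength : Measure Circle :=
  (volume.restrict (Ioc (-Real.pi) Real.pi)).map Circle.exp

/-- The complementary arcs of a subset `E` of the unit circle: the connected components of the
complement of `E`. -/
def complementaryArcs (E : Set Circle) : Set (Set Circle) :=
  {J | ∃ z ∈ Eᶜ, J = connectedComponentIn Eᶜ z}

/-- `α`-Beurling--Carleson sets: closed sets of zero length whose complementary arcs `J` satisfy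
`∑ |J| ^ α < ∞`. -/
def IsBeurlingCarleson (α : ℝ) (E : Set Circle) : Prop :=
  IsClosed E ∧ arcLength E = 0 ∧ ∑' J : complementaryArcs E, arcLength (J : Set Circle) ^ α < ∞

/-- The singular inner function
`S_μ(z) = exp (- ∫ (ζ + z) / (ζ - z) dμ(ζ))` (only its values for `|z| < 1` matter). -/
def singularInner (μ : Measure Circle) (z : ℂ) : ℂ :=
  Complex.exp (-∫ ζ : Circle, ((ζ : ℂ) + z) / ((ζ : ℂ) - z) ∂μ)

/-- The Hardy space `H^p` of the unit disk: `f` is analytic for `|z| < 1` and the integrals of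
`|f| ^ p` over the circles `|z| = r`, `0 ≤ r < 1`, are uniformly bounded. -/
def MemHardy (p : ℝ) (f : ℂ → ℂ) : Prop :=
  DifferentiableOn ℂ f (Metric.ball 0 1) ∧
    ∃ C : ℝ≥0, ∀ r ∈ Ico (0 : ℝ) 1,
      ∫⁻ θ in Ioc (-Real.pi) Real.pi, ‖f (circleMap 0 r θ)‖ₑ ^ p ≤ C

/-- `S'_μ ∈ H^p`. -/
def DerivMemHardy (p : ℝ) (μ : Measure Circle) : Prop :=
  MemHardy p (deriv (singularInner μ))

/-- `μ` is concentrated on a countable union of `α`-Beurling--Carleson sets. -/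
def ConcentratedOnBeurlingCarleson (α : ℝ) (μ : Measure Circle) : Prop :=
  ∃ E : ℕ → Set Circle, (∀ k, IsBeurlingCarleson α (E k)) ∧ μ (⋃ k, E k)ᶜ = 0

/-- `μ` satisfies the property `P` up to countable sums: it is a countable sum of finite measures
satisfying `P`. -/
def UpToCountableSums (P : Measure Circle → Prop) (μ : Measure Circle) : Prop :=
  ∃ m : ℕ → Measure Circle, (∀ k, IsFiniteMeasure (m k) ∧ P (m k)) ∧ μ = Measure.sum m

/-- Left endpoint (as an angle) of the arc of generation `n` with address `w`; at step `k` one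
passes from an arc of length `A ^ (-k)` to its left (`false`) or right (`true`) end piece of
length `A ^ (-(k + 1))`. -/
def cantorLeft (A : ℝ) (n : ℕ) (w : Fin n → Bool) : ℝ :=
  ∑ k : Fin n, if w k then A⁻¹ ^ (k : ℕ) - A⁻¹ ^ ((k : ℕ) + 1) else 0

/-- The `2 ^ n` closed arcs of generation `n`, each of length `A ^ (-n)`. -/
def cantorArc (A : ℝ) (n : ℕ) (w : Fin n → Bool) : Set Circle :=
  Circle.exp '' Icc (cantorLeft A n w) (cantorLeft A n w + A⁻¹ ^ n)

/-- The standard Cantor set on the circle with parameter `A > 2`. -/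
def circleCantorSet (A : ℝ) : Set Circle :=
  ⋂ n : ℕ, ⋃ w : Fin n → Bool, cantorArc A n w

/-- `μ` is the standard Cantor measure on the Cantor set with parameter `A`: the probability
measure supported on it which gives equal mass to all the arcs of each generation. -/
def IsCantorMeasure (A : ℝ) (μ : Measure Circle) : Prop :=
  IsProbabilityMeasure μ ∧ μ (circleCantorSet A)ᶜ = 0 ∧
    ∀ (n : ℕ) (w : Fin n → Bool), μ (cantorArc A n w) = (2⁻¹ : ℝ≥0∞) ^ n

end

/-! Off a closed carrier `E` of `ν`, the function `S_ν` extends analytically across the circle.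
There `|S_ν| = 1` and `|S_ν'(z)| = ∫ 2 / |ζ - z|² dν(ζ)`, an integral without cancellation
(`norm_deriv_singularInner_circle`).

Let `0 < ν ≤ μ` with `μ` the Cantor measure, and let `m` be the total mass of `ν`. Since each arc of
generation `n` has `μ`-mass `2⁻ⁿ`, at least `(m/2) 2ⁿ` of them have `ν`-mass at least `(m/2) 2⁻ⁿ`
(`le_card_heavyAddresses`). In the middle gap of such an arc `|S_ν'| ≥ m (A²/2)ⁿ`, and these gaps
have total length at least a constant times `(2/A)ⁿ`. By Fatou, `S_ν' ∈ H^p` would bound `((2/A)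
(A²/2)^p)ⁿ` uniformly in `n`, which fails when `A^(1-2p) < 2^(1-p)`
(`not_derivMemHardy_of_le_cantorMeasure`).

On the other hand `E_A` is `(1-q)`-Beurling--Carleson once `A^(1-q) > 2`, because the sum over the
gaps is dominated by a geometric series. With `A = 2^s` the two conditions read `1/(1-q) < s <
(1-p)/(1-2p)`, and such an `s` exists as soon as `q < p/(1-p)`. This gives (a). As `p < p/(1-p)`,
(b) is the case `q = p`: every summand of `μ` lies below `μ`, hence vanishes. For (c), take `ν = μ`.
-/

noncomputable section

/-! ### Combinatorics of the Cantor arcs -/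

/-- The angle interval of generation `n` with address `w`. -/
def cantorInterval (A : ℝ) (n : ℕ) (w : Fin n → Bool) : Set ℝ :=
  Icc (cantorLeft A n w) (cantorLeft A n w + A⁻¹ ^ n)

/-- The open middle gap of the angle interval of generation `n` with address `w`. -/
def cantorGap (A : ℝ) (n : ℕ) (w : Fin n → Bool) : Set ℝ :=
  Ioo (cantorLeft A n w + A⁻¹ ^ (n + 1)) (cantorLeft A n w + A⁻¹ ^ n - A⁻¹ ^ (n + 1))

/-- The angle of the point of the Cantor set with infinite address `x`. -/
def cantorPoint (A : ℝ) (x : ℕ → Bool) : ℝ :=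
  ∑' k : ℕ, if x k then A⁻¹ ^ k - A⁻¹ ^ (k + 1) else 0

/-- The first `n` letters of an infinite address. -/
def addressPrefix (n : ℕ) (x : ℕ → Bool) : Fin n → Bool := fun i => x i

/-- The infinite address that continues `w` by the constant `b`. -/
def addressExtend {n : ℕ} (w : Fin n → Bool) (b : Bool) : ℕ → Bool :=
  fun k => if h : k < n then w ⟨k, h⟩ else b

lemma addressPrefix_extend {n : ℕ} (w : Fin n → Bool) (b : Bool) :
    addressPrefix n (addressExtend w b) = w := by
  ext i
  simp [addressPrefix, addressExtend]

lemma inv_pow_succ_lt_half {A : ℝ} (hA : 2 < A) (n : ℕ) : 2 * A⁻¹ ^ (n + 1) < A⁻¹ ^ n := by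
  have h0 : 0 < A := by linarith
  have h1 : A⁻¹ < 2⁻¹ := inv_strictAnti₀ two_pos hA
  have h2 : 0 < A⁻¹ ^ n := by positivity
  rw [pow_succ]
  nlinarith

lemma cantorLeft_succ (A : ℝ) (n : ℕ) (w : Fin (n + 1) → Bool) :
    cantorLeft A (n + 1) w = cantorLeft A n (Fin.init w) +
      if w (Fin.last n) then A⁻¹ ^ n - A⁻¹ ^ (n + 1) else 0 := by
  simp [cantorLeft, Fin.sum_univ_castSucc, Fin.init]

lemma cantorInterval_subset_init {A : ℝ} (hA : 2 < A) (n : ℕ) (w : Fin (n + 1) → Bool) :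
    cantorInterval A (n + 1) w ⊆ cantorInterval A n (Fin.init w) := by
  have h := inv_pow_succ_lt_half hA n
  have h0 : 0 < A⁻¹ ^ (n + 1) := by have : 0 < A := by linarith
                                    positivity
  rintro t ⟨h1, h2⟩
  rw [cantorLeft_succ] at h1 h2
  split_ifs at h1 h2 <;> constructor <;> linarith

lemma cantorInterval_subset_unit {A : ℝ} (hA : 2 < A) (n : ℕ) (w : Fin n → Bool) :
    cantorInterval A n w ⊆ Icc 0 1 := by
  induction n with
  | zero => simp [cantorInterval, cantorLeft]
  | succ n ih => exact (cantorInterval_subset_init hA n w).trans (ih _)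

/-- The two children of an interval are disjoint even as closed sets, because `2 A⁻ⁿ⁻¹ < A⁻ⁿ`
strictly; induction on the generation does the rest. -/
lemma eq_of_mem_cantorInterval {A : ℝ} (hA : 2 < A) {n : ℕ} {w w' : Fin n → Bool} {t : ℝ}
    (h : t ∈ cantorInterval A n w) (h' : t ∈ cantorInterval A n w') : w = w' := by
  induction n with
  | zero => exact Subsingleton.elim _ _
  | succ n ih =>
    have hi := ih (cantorInterval_subset_init hA n w h) (cantorInterval_subset_init hA n w' h')
    have hl : w (Fin.last n) = w' (Fin.last n) := by
      have hh := inv_pow_succ_lt_half hA n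
      rw [cantorInterval, cantorLeft_succ] at h h'
      rw [hi] at h
      obtain ⟨h1, h2⟩ := h
      obtain ⟨h3, h4⟩ := h'
      cases hw : w (Fin.last n) <;> cases hw' : w' (Fin.last n) <;> simp_all <;> linarith
    rw [← Fin.snoc_init_self w, ← Fin.snoc_init_self w', hi, hl]

lemma cantorGap_subset_interval {A : ℝ} (hA : 2 < A) (n : ℕ) (w : Fin n → Bool) :
    cantorGap A n w ⊆ cantorInterval A n w := by
  have h0 : 0 < A⁻¹ ^ (n + 1) := by have : 0 < A := by linarith
                                    positivity
  rintro t ⟨h1, h2⟩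
  constructor <;> linarith

lemma notMem_cantorInterval_of_mem_gap {A : ℝ} (hA : 2 < A) {n : ℕ} {w : Fin n → Bool} {t : ℝ}
    (h : t ∈ cantorGap A n w) (w' : Fin (n + 1) → Bool) : t ∉ cantorInterval A (n + 1) w' := by
  intro h'
  have hi := eq_of_mem_cantorInterval hA (cantorGap_subset_interval hA n w h)
    (cantorInterval_subset_init hA n w' h')
  obtain ⟨h1, h2⟩ := h
  rw [cantorInterval, cantorLeft_succ, ← hi] at h'
  obtain ⟨h3, h4⟩ := h'
  split_ifs at h3 h4 <;> linarith

lemma mem_cantorGap_of_notMem {A : ℝ} {n : ℕ} {w : Fin n → Bool} {t : ℝ}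
    (h : t ∈ cantorInterval A n w) (h' : ∀ w', t ∉ cantorInterval A (n + 1) w') :
    t ∈ cantorGap A n w := by
  have key : ∀ b, t ∉ cantorInterval A (n + 1) (Fin.snoc w b : Fin (n + 1) → Bool) :=
    fun b => h' _
  simp only [cantorInterval, cantorLeft_succ, Fin.init_snoc, Fin.snoc_last, mem_Icc, not_and,
    not_le] at key
  obtain ⟨h1, h2⟩ := h
  constructor
  · have := key false
    simp only [Bool.false_eq_true, if_false] at this
    linarith [this (by linarith)]
  · by_contra hc
    have := key true
    simp only [if_true] at this
    linarith [this (by linarith)]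

lemma exists_mem_cantorGap {A : ℝ} {t : ℝ} (h01 : t ∈ Icc (0 : ℝ) 1)
    (h : ∃ n, ∀ w, t ∉ cantorInterval A n w) : ∃ n w, t ∈ cantorGap A n w := by
  classical
  -- At the least generation whose intervals all miss `t`, the interval of the preceding generation
  -- that contains `t` has `t` in its gap.
  have hn := Nat.find_spec h
  obtain hz | hm := Nat.eq_zero_or_eq_succ_pred (Nat.find h)
  · rw [hz] at hn
    exact absurd h01 (by simpa [cantorInterval, cantorLeft] using hn)
  · have hlt : Nat.pred (Nat.find h) < Nat.find h := by omega
    have := Nat.find_min h hlt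
    push Not at this
    obtain ⟨w, hw⟩ := this
    refine ⟨_, w, mem_cantorGap_of_notMem hw ?_⟩
    rw [hm] at hn
    exact hn

/-- This is the tail of the address that is constantly `true`: it leads from the left end of an
interval of generation `n` exactly to its right end. -/
lemma hasSum_inv_pow_sub {A : ℝ} (hA : 2 < A) (n : ℕ) :
    HasSum (fun k : ℕ => A⁻¹ ^ (k + n) - A⁻¹ ^ (k + n + 1)) (A⁻¹ ^ n) := by
  have h0 : 0 < A := by linarith
  have h1 : A⁻¹ < 2⁻¹ := inv_strictAnti₀ two_pos hA
  have := (hasSum_geometric_of_lt_one (by positivity : 0 ≤ A⁻¹) (by linarith)).mul_left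
    (A⁻¹ ^ n * (1 - A⁻¹))
  rw [mul_assoc, mul_inv_cancel₀ (by linarith), mul_one] at this
  have e : (fun k : ℕ => A⁻¹ ^ (k + n) - A⁻¹ ^ (k + n + 1)) =
      fun k : ℕ => A⁻¹ ^ n * (1 - A⁻¹) * A⁻¹ ^ k := by
    ext k
    ring
  rw [e]
  exact this

lemma inv_pow_sub_nonneg {A : ℝ} (hA : 2 < A) (k : ℕ) : 0 ≤ A⁻¹ ^ k - A⁻¹ ^ (k + 1) := by
  have h := inv_pow_succ_lt_half hA k
  have h0 : 0 < A⁻¹ ^ (k + 1) := by have : 0 < A := by linarith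
                                    positivity
  linarith

lemma cantorPoint_term_nonneg {A : ℝ} (hA : 2 < A) (x : ℕ → Bool) (k : ℕ) :
    0 ≤ if x k then A⁻¹ ^ k - A⁻¹ ^ (k + 1) else 0 := by
  split_ifs
  · exact inv_pow_sub_nonneg hA k
  · rfl

lemma cantorPoint_term_le {A : ℝ} (hA : 2 < A) (x : ℕ → Bool) (k : ℕ) :
    (if x k then A⁻¹ ^ k - A⁻¹ ^ (k + 1) else 0) ≤ A⁻¹ ^ k - A⁻¹ ^ (k + 1) := by
  split_ifs
  · rfl
  · exact inv_pow_sub_nonneg hA k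

lemma summable_cantorPoint {A : ℝ} (hA : 2 < A) (x : ℕ → Bool) :
    Summable fun k : ℕ => if x k then A⁻¹ ^ k - A⁻¹ ^ (k + 1) else 0 :=
  Summable.of_nonneg_of_le (cantorPoint_term_nonneg hA x) (cantorPoint_term_le hA x)
    (hasSum_inv_pow_sub hA 0).summable

lemma cantorPoint_eq {A : ℝ} (hA : 2 < A) (n : ℕ) (x : ℕ → Bool) :
    cantorPoint A x = cantorLeft A n (addressPrefix n x) +
      ∑' k : ℕ, if x (k + n) then A⁻¹ ^ (k + n) - A⁻¹ ^ (k + n + 1) else 0 := by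
  rw [cantorPoint, ← (summable_cantorPoint hA x).sum_add_tsum_nat_add n, Finset.sum_range]
  rfl

lemma cantorPoint_mem {A : ℝ} (hA : 2 < A) (n : ℕ) (x : ℕ → Bool) :
    cantorPoint A x ∈ cantorInterval A n (addressPrefix n x) := by
  rw [cantorPoint_eq hA n]
  have hs := (summable_nat_add_iff n).2 (summable_cantorPoint hA x)
  constructor
  · linarith [tsum_nonneg (L := .unconditional ℕ) fun k => cantorPoint_term_nonneg hA x (k + n)]
  · have := hs.tsum_le_tsum (fun k => cantorPoint_term_le hA x (k + n))
      (hasSum_inv_pow_sub hA n).summable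
    rw [(hasSum_inv_pow_sub hA n).tsum_eq] at this
    linarith

lemma cantorPoint_extend {A : ℝ} (hA : 2 < A) {n : ℕ} (w : Fin n → Bool) (b : Bool) :
    cantorPoint A (addressExtend w b) = cantorLeft A n w + if b then A⁻¹ ^ n else 0 := by
  rw [cantorPoint_eq hA n, addressPrefix_extend]
  cases b
  · simp [addressExtend]
  · simpa [addressExtend] using (hasSum_inv_pow_sub hA n).tsum_eq

lemma continuous_cantorPoint {A : ℝ} (hA : 2 < A) : Continuous (cantorPoint A) := by
  refine continuous_tsum (u := fun k : ℕ => A⁻¹ ^ k - A⁻¹ ^ (k + 1)) (fun k => ?_)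
    (hasSum_inv_pow_sub hA 0).summable fun k x => ?_
  · exact (continuous_of_discreteTopology (f := fun b : Bool =>
      if b then A⁻¹ ^ k - A⁻¹ ^ (k + 1) else 0)).comp (continuous_apply k)
  · rw [Real.norm_of_nonneg (cantorPoint_term_nonneg hA x k)]
    exact cantorPoint_term_le hA x k

lemma cantorPoint_mem_iff {A : ℝ} (hA : 2 < A) {n : ℕ} {w : Fin n → Bool} {x : ℕ → Bool} :
    cantorPoint A x ∈ cantorInterval A n w ↔ addressPrefix n x = w :=
  ⟨fun h => eq_of_mem_cantorInterval hA (cantorPoint_mem hA n x) h,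
    fun h => h ▸ cantorPoint_mem hA n x⟩

/-! ### The Cantor set and the Cantor measure on the circle -/

lemma unit_subset_Ioc_pi : Icc (0 : ℝ) 1 ⊆ Ioc (-Real.pi) Real.pi := fun t ht =>
  ⟨by linarith [Real.pi_pos, ht.1], by linarith [Real.pi_gt_three, ht.2]⟩

lemma Circle.injOn_exp_Ioc_pi : InjOn Circle.exp (Ioc (-Real.pi) Real.pi) :=
  Circle.exp_injOn_Ioc (by linarith)

lemma Circle.exp_mem_image_iff {S : Set ℝ} (hS : S ⊆ Ioc (-Real.pi) Real.pi) {t : ℝ}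
    (ht : t ∈ Ioc (-Real.pi) Real.pi) : Circle.exp t ∈ Circle.exp '' S ↔ t ∈ S := by
  refine ⟨?_, fun h => ⟨t, h, rfl⟩⟩
  rintro ⟨s, hs, hst⟩
  exact Circle.injOn_exp_Ioc_pi (hS hs) ht hst ▸ hs

lemma Circle.isOpenMap_exp : IsOpenMap Circle.exp := isLocalHomeomorph_circleExp.isOpenMap

lemma Circle.measurable_exp : Measurable Circle.exp := Circle.exp.continuous.measurable

lemma arcLength_image {S : Set ℝ} (hS : S ⊆ Ioc (-Real.pi) Real.pi)
    (hm : MeasurableSet (Circle.exp '' S)) : arcLength (Circle.exp '' S) = volume S := by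
  rw [arcLength, Measure.map_apply Circle.measurable_exp hm,
    Measure.restrict_apply (Circle.measurable_exp hm)]
  congr 1
  ext t
  refine ⟨fun ⟨h1, h2⟩ => (Circle.exp_mem_image_iff hS h2).1 h1, fun h => ⟨⟨t, h, rfl⟩, hS h⟩⟩

lemma arcLength_univ : arcLength univ = ENNReal.ofReal (2 * Real.pi) := by
  rw [arcLength, Measure.map_apply Circle.measurable_exp .univ, preimage_univ,
    Measure.restrict_apply_univ, Real.volume_Ioc]
  congr 1
  ring

lemma cantorArc_eq (A : ℝ) (n : ℕ) (w : Fin n → Bool) :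
    cantorArc A n w = Circle.exp '' cantorInterval A n w := rfl

lemma isClosed_cantorArc (A : ℝ) (n : ℕ) (w : Fin n → Bool) : IsClosed (cantorArc A n w) :=
  (isCompact_Icc.image Circle.exp.continuous).isClosed

lemma isClosed_circleCantorSet (A : ℝ) : IsClosed (circleCantorSet A) :=
  isClosed_iInter fun n => isClosed_iUnion_of_finite fun w => isClosed_cantorArc A n w

lemma cantorInterval_subset_Ioc_pi {A : ℝ} (hA : 2 < A) (n : ℕ) (w : Fin n → Bool) :
    cantorInterval A n w ⊆ Ioc (-Real.pi) Real.pi :=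
  (cantorInterval_subset_unit hA n w).trans unit_subset_Ioc_pi

lemma exp_mem_circleCantorSet_iff {A : ℝ} (hA : 2 < A) {t : ℝ}
    (ht : t ∈ Ioc (-Real.pi) Real.pi) :
    Circle.exp t ∈ circleCantorSet A ↔ ∀ n, ∃ w, t ∈ cantorInterval A n w := by
  simp only [circleCantorSet, mem_iInter, mem_iUnion, cantorArc_eq,
    Circle.exp_mem_image_iff (cantorInterval_subset_Ioc_pi hA _ _) ht]

lemma exp_cantorPoint_mem {A : ℝ} (hA : 2 < A) (x : ℕ → Bool) :
    Circle.exp (cantorPoint A x) ∈ circleCantorSet A :=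
  (exp_mem_circleCantorSet_iff hA
    (cantorInterval_subset_Ioc_pi hA 0 _ (cantorPoint_mem hA 0 x))).2
    fun n => ⟨_, cantorPoint_mem hA n x⟩

lemma exp_cantorGap_notMem {A : ℝ} (hA : 2 < A) {n : ℕ} {w : Fin n → Bool} {t : ℝ}
    (ht : t ∈ cantorGap A n w) : Circle.exp t ∉ circleCantorSet A := by
  rw [exp_mem_circleCantorSet_iff hA
    (cantorInterval_subset_Ioc_pi hA n w (cantorGap_subset_interval hA n w ht))]
  intro h
  obtain ⟨w', hw'⟩ := h (n + 1)
  exact notMem_cantorInterval_of_mem_gap hA ht w' hw'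

/-- The Cantor measure: the law of `Circle.exp (cantorPoint A x)` for fair coin tosses `x`. -/
def cantorMeasure (A : ℝ) : Measure Circle :=
  (Measure.infinitePi fun _ : ℕ => (PMF.uniformOfFintype Bool).toMeasure).map
    fun x => Circle.exp (cantorPoint A x)

lemma isCantorMeasure_cantorMeasure {A : ℝ} (hA : 2 < A) :
    IsCantorMeasure A (cantorMeasure A) := by
  have hm : Measurable fun x : ℕ → Bool => Circle.exp (cantorPoint A x) :=
    (Circle.exp.continuous.comp (continuous_cantorPoint hA)).measurable
  refine ⟨Measure.isProbabilityMeasure_map hm.aemeasurable, ?_, fun n w => ?_⟩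
  · rw [cantorMeasure, Measure.map_apply hm (isClosed_circleCantorSet A).measurableSet.compl]
    have he : (fun x : ℕ → Bool => Circle.exp (cantorPoint A x)) ⁻¹' (circleCantorSet A)ᶜ = ∅ :=
      eq_empty_of_forall_notMem fun x hx => hx (exp_cantorPoint_mem hA x)
    rw [he, measure_empty]
  · rw [cantorMeasure, Measure.map_apply hm (isClosed_cantorArc A n w).measurableSet]
    -- An arc of generation `n` pulls back to the cylinder fixing the first `n` letters. The filler
    -- `false` is never read, since only indices below `n` occur.
    have hset : (fun x : ℕ → Bool => Circle.exp (cantorPoint A x)) ⁻¹' cantorArc A n w =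
        Set.pi (Finset.range n) fun k => {addressExtend w false k} := by
      ext x
      rw [mem_preimage, cantorArc_eq, Circle.exp_mem_image_iff (cantorInterval_subset_Ioc_pi hA n w)
        (cantorInterval_subset_Ioc_pi hA 0 _ (cantorPoint_mem hA 0 x)), cantorPoint_mem_iff hA]
      simp only [Set.mem_pi, Finset.coe_range, mem_Iio, mem_singleton_iff]
      constructor
      · rintro rfl k hk
        simp [addressExtend, addressPrefix, hk]
      · intro h
        ext i
        simpa [addressExtend, addressPrefix] using h i i.2
    rw [hset, Measure.infinitePi_pi _ fun _ _ => measurableSet_singleton _]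
    simp

/-! ### The Beurling--Carleson condition -/

lemma arcLength_circleCantorSet {A : ℝ} (hA : 2 < A) : arcLength (circleCantorSet A) = 0 := by
  have h0 : 0 < A := by linarith
  have hle : ∀ n : ℕ, arcLength (circleCantorSet A) ≤ ENNReal.ofReal ((2 * A⁻¹) ^ n) := by
    intro n
    calc arcLength (circleCantorSet A) ≤ arcLength (⋃ w : Fin n → Bool, cantorArc A n w) :=
          measure_mono (iInter_subset _ n)
      _ ≤ ∑ w : Fin n → Bool, arcLength (cantorArc A n w) := measure_iUnion_fintype_le _ _
      _ = ENNReal.ofReal ((2 * A⁻¹) ^ n) := by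
          have : ∀ w : Fin n → Bool, arcLength (cantorArc A n w) = ENNReal.ofReal (A⁻¹ ^ n) := by
            intro w
            rw [cantorArc_eq, arcLength_image (cantorInterval_subset_Ioc_pi hA n w)
              (isClosed_cantorArc A n w).measurableSet, cantorInterval, Real.volume_Icc,
              add_sub_cancel_left]
          simp only [this, Finset.sum_const, Finset.card_univ, Fintype.card_pi, Fintype.card_bool,
            Finset.prod_const, Fintype.card_fin]
          rw [mul_pow, ENNReal.ofReal_mul (by positivity), nsmul_eq_mul]
          simp
  have hlim : Filter.Tendsto (fun n : ℕ => ENNReal.ofReal ((2 * A⁻¹) ^ n)) Filter.atTop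
      (nhds 0) := by
    rw [← ENNReal.ofReal_zero]
    refine ENNReal.tendsto_ofReal (tendsto_pow_atTop_nhds_zero_of_lt_one (by positivity) ?_)
    rw [← div_eq_mul_inv, div_lt_one h0]
    exact hA
  exact le_antisymm (ge_of_tendsto' hlim hle) bot_le

/-- The complementary arcs of the Cantor set: the gaps and the large outer arc. -/
def cantorComplementArc (A : ℝ) : Option (Σ n, Fin n → Bool) → Set Circle
  | none => Circle.exp '' Ioo 1 (2 * Real.pi)
  | some i => Circle.exp '' cantorGap A i.1 i.2

lemma exp_outer_notMem {A : ℝ} (hA : 2 < A) {t : ℝ} (ht : t ∈ Ioo 1 (2 * Real.pi)) :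
    Circle.exp t ∉ circleCantorSet A := by
  intro h
  obtain ⟨w, s, hs, hst⟩ := mem_iUnion.1 (mem_iInter.1 h 0)
  have hs1 := cantorInterval_subset_unit hA 0 w hs
  -- The outer arc passes through angle `π`, so angles are compared in `[0, 2π)` here instead of
  -- `(-π, π]`.
  have : s = t := Circle.exp_injOn_Ico (a := 0) (b := 2 * Real.pi) (by linarith)
    ⟨hs1.1, by linarith [hs1.2, Real.pi_gt_three]⟩ ⟨by linarith [ht.1], ht.2⟩ hst
  linarith [hs1.2, ht.1]

lemma cantorComplementArc_subset {A : ℝ} (hA : 2 < A) (i : Option (Σ n, Fin n → Bool)) :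
    cantorComplementArc A i ⊆ (circleCantorSet A)ᶜ := by
  rcases i with _ | i
  · rintro _ ⟨t, ht, rfl⟩
    exact exp_outer_notMem hA ht
  · rintro _ ⟨t, ht, rfl⟩
    exact exp_cantorGap_notMem hA ht

lemma isPreconnected_cantorComplementArc (A : ℝ) (i : Option (Σ n, Fin n → Bool)) :
    IsPreconnected (cantorComplementArc A i) := by
  rcases i with _ | i
  · exact isPreconnected_Ioo.image _ Circle.exp.continuous.continuousOn
  · exact isPreconnected_Ioo.image _ Circle.exp.continuous.continuousOn

lemma exists_mem_cantorComplementArc {A : ℝ} (hA : 2 < A) {z : Circle}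
    (hz : z ∉ circleCantorSet A) : ∃ i, z ∈ cantorComplementArc A i := by
  obtain ⟨t, ht, rfl⟩ : ∃ t ∈ Ico (0 : ℝ) (2 * Real.pi), Circle.exp t = z := by
    obtain ⟨s, rfl⟩ := Circle.exp_surjective z
    obtain ⟨t, ht, hst⟩ := Circle.periodic_exp.exists_mem_Ico₀ Real.two_pi_pos s
    exact ⟨t, ht, hst.symm⟩
  by_cases h1 : 1 < t
  · exact ⟨none, t, ⟨h1, ht.2⟩, rfl⟩
  · have h01 : t ∈ Icc (0 : ℝ) 1 := ⟨ht.1, not_lt.1 h1⟩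
    rw [exp_mem_circleCantorSet_iff hA (unit_subset_Ioc_pi h01)] at hz
    push Not at hz
    obtain ⟨n, w, hw⟩ := exists_mem_cantorGap h01 hz
    exact ⟨some ⟨n, w⟩, t, hw, rfl⟩

/-- The endpoints have the addresses `w, false, true, true, …` and `w, true, false, false, …`. -/
lemma cantorGap_endpoints_mem {A : ℝ} (hA : 2 < A) (n : ℕ) (w : Fin n → Bool) :
    Circle.exp (cantorLeft A n w + A⁻¹ ^ (n + 1)) ∈ circleCantorSet A ∧
      Circle.exp (cantorLeft A n w + A⁻¹ ^ n - A⁻¹ ^ (n + 1)) ∈ circleCantorSet A := by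
  constructor
  · convert exp_cantorPoint_mem hA
      (addressExtend (Fin.snoc w false : Fin (n + 1) → Bool) true) using 2
    rw [cantorPoint_extend hA, cantorLeft_succ]
    simp
  · convert exp_cantorPoint_mem hA
      (addressExtend (Fin.snoc w true : Fin (n + 1) → Bool) false) using 2
    rw [cantorPoint_extend hA, cantorLeft_succ]
    simp only [Fin.init_snoc, Fin.snoc_last, if_true, Bool.false_eq_true, if_false]
    ring

/-- The endpoints of the gap lie in the Cantor set, so the component is covered by two disjoint open
sets: the open gap and the complement of the closed gap. It meets the former, so it stays there. -/
lemma connectedComponentIn_subset_gap {A : ℝ} (hA : 2 < A) {n : ℕ} {w : Fin n → Bool}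
    {z : Circle} (hz : z ∈ Circle.exp '' cantorGap A n w) :
    connectedComponentIn (circleCantorSet A)ᶜ z ⊆ Circle.exp '' cantorGap A n w := by
  set a := cantorLeft A n w + A⁻¹ ^ (n + 1)
  set b := cantorLeft A n w + A⁻¹ ^ n - A⁻¹ ^ (n + 1)
  have hzc : z ∈ (circleCantorSet A)ᶜ := cantorComplementArc_subset hA (some ⟨n, w⟩) hz
  refine isPreconnected_connectedComponentIn.subset_left_of_subset_union
    (Circle.isOpenMap_exp _ isOpen_Ioo)
    (isCompact_Icc.image Circle.exp.continuous : IsCompact (Circle.exp '' Icc a b)).isClosed.isOpen_compl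
    ?_ ?_ ⟨z, mem_connectedComponentIn hzc, hz⟩
  · rw [disjoint_compl_right_iff_subset]
    exact image_mono Ioo_subset_Icc_self
  · intro y hy
    have hyc := connectedComponentIn_subset _ _ hy
    by_contra hcon
    rw [mem_union, not_or, notMem_compl_iff] at hcon
    obtain ⟨h1, t, ht, rfl⟩ := hcon
    have he := cantorGap_endpoints_mem hA n w
    rcases eq_or_lt_of_le ht.1 with h | h
    · exact hyc (h ▸ he.1)
    rcases eq_or_lt_of_le ht.2 with h' | h'
    · exact hyc (h' ▸ he.2)
    exact h1 ⟨t, ⟨h, h'⟩, rfl⟩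

lemma tsum_cantorGap_lt_top {A α : ℝ} (hA : 2 < A) (hα : 0 < α) (h : 2 < A ^ α) :
    ∑' i : Σ n, Fin n → Bool, ENNReal.ofReal (A⁻¹ ^ i.1) ^ α < ∞ := by
  have h0 : 0 < A := by linarith
  rw [ENNReal.tsum_sigma']
  have : ∀ n : ℕ, ∑' _ : Fin n → Bool, ENNReal.ofReal (A⁻¹ ^ n) ^ α =
      ENNReal.ofReal ((2 * (A ^ α)⁻¹) ^ n) := by
    intro n
    rw [tsum_fintype]
    simp only [Finset.sum_const, Finset.card_univ, Fintype.card_pi, Fintype.card_bool,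
      Finset.prod_const, Fintype.card_fin]
    rw [ENNReal.ofReal_rpow_of_nonneg (by positivity) hα.le, mul_pow,
      ENNReal.ofReal_mul (by positivity), nsmul_eq_mul, ← Real.inv_rpow h0.le,
      ← Real.rpow_natCast (A⁻¹) n, ← Real.rpow_natCast (A⁻¹ ^ α) n, ← Real.rpow_mul (by positivity),
      ← Real.rpow_mul (by positivity), mul_comm α]
    simp
  simp only [this]
  have hpos : 0 < A ^ α := by positivity
  have hs : Summable fun n : ℕ => (2 * (A ^ α)⁻¹) ^ n := by
    refine summable_geometric_of_lt_one (by positivity) ?_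
    rwa [← div_eq_mul_inv, div_lt_one hpos]
  rw [← ENNReal.ofReal_tsum_of_nonneg (fun n => by positivity) hs]
  exact ENNReal.ofReal_lt_top

/-- Only an upper bound is needed, so components are not identified with gaps: each one is
injectively assigned a gap, or the outer arc, that meets it. -/
lemma isBeurlingCarleson_circleCantorSet {A α : ℝ} (hA : 2 < A) (hα : 0 < α) (h : 2 < A ^ α) :
    IsBeurlingCarleson α (circleCantorSet A) := by
  refine ⟨isClosed_circleCantorSet A, arcLength_circleCantorSet hA, ?_⟩
  have h0 : 0 < A := by linarith
  have hpt : ∀ J : complementaryArcs (circleCantorSet A), ∃ z i,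
      z ∈ cantorComplementArc A i ∧ (J : Set Circle) =
        connectedComponentIn (circleCantorSet A)ᶜ z := by
    rintro ⟨J, z, hz, rfl⟩
    obtain ⟨i, hi⟩ := exists_mem_cantorComplementArc hA hz
    exact ⟨z, i, hi, rfl⟩
  choose z i hzi hJ using hpt
  -- Two components that meet the same connected arc off the Cantor set coincide.
  have hinj : Function.Injective i := by
    intro J J' hJJ
    have h1 : z J' ∈ connectedComponentIn (circleCantorSet A)ᶜ (z J) :=
      (isPreconnected_cantorComplementArc A (i J)).subset_connectedComponentIn (hzi J)
        (cantorComplementArc_subset hA _) (hJJ ▸ hzi J')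
    exact Subtype.ext ((hJ J).trans ((connectedComponentIn_eq h1).trans (hJ J').symm))
  let f : Option (Σ n, Fin n → Bool) → ℝ≥0∞ := fun i =>
    i.elim (arcLength univ ^ α) fun i => ENNReal.ofReal (A⁻¹ ^ i.1) ^ α
  have hle : ∀ J : complementaryArcs (circleCantorSet A), arcLength (J : Set Circle) ^ α ≤
      f (i J) := by
    intro J
    have hz := hzi J
    rw [hJ J]
    rcases hi : i J with _ | ⟨n, w⟩
    · exact ENNReal.rpow_le_rpow (measure_mono (subset_univ _)) hα.le
    · rw [hi] at hz
      refine ENNReal.rpow_le_rpow ((measure_mono (connectedComponentIn_subset_gap hA hz)).trans ?_)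
        hα.le
      rw [arcLength_image ((cantorGap_subset_interval hA n w).trans
        (cantorInterval_subset_Ioc_pi hA n w))
        (Circle.isOpenMap_exp _ isOpen_Ioo).measurableSet]
      refine (measure_mono (cantorGap_subset_interval hA n w)).trans ?_
      rw [cantorInterval, Real.volume_Icc, add_sub_cancel_left]
  refine (ENNReal.tsum_le_tsum hle).trans_lt
    ((ENNReal.tsum_comp_le_tsum_of_injective hinj f).trans_lt ?_)
  have hsome : ∑' j, f j = f none + ∑' j, f (some j) := by
    rw [ENNReal.tsum_eq_add_tsum_ite none, ← (Option.some_injective _).tsum_eq]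
    · simp
    · rintro (_ | j) hj
      · simp at hj
      · exact ⟨j, rfl⟩
  rw [hsome]
  refine ENNReal.add_lt_top.2 ⟨?_, tsum_cantorGap_lt_top hA hα h⟩
  refine ENNReal.rpow_lt_top_of_nonneg hα.le ?_
  rw [arcLength_univ]
  exact ENNReal.ofReal_ne_top

/-! ### Singular inner functions off the support -/

lemma continuous_circle_coe : Continuous fun ζ : Circle => (ζ : ℂ) := by
  fun_prop

open Filter Topology in
-- Differentiation under the integral sign. Points of the circle outside `E` are allowed, since near
-- them the kernel is bounded for `ζ ∈ E`.
lemma hasDerivAt_singularInner {ν : Measure Circle} [IsFiniteMeasure ν] {E : Set Circle}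
    (hE : IsClosed E) (hν : ν Eᶜ = 0) {z : ℂ} (hz : z ∉ (fun ζ : Circle => (ζ : ℂ)) '' E) :
    HasDerivAt (singularInner ν)
      (singularInner ν z * -∫ ζ : Circle, 2 * (ζ : ℂ) / ((ζ : ℂ) - z) ^ 2 ∂ν) z := by
  have hclosed : IsClosed ((fun ζ : Circle => (ζ : ℂ)) '' E) :=
    (hE.isCompact.image continuous_circle_coe).isClosed
  obtain ⟨δ, hδ, hball⟩ := Metric.isOpen_iff.1 hclosed.isOpen_compl z hz
  have hdist : ∀ ζ ∈ E, ∀ x ∈ Metric.ball z (δ / 2), δ / 2 ≤ ‖(ζ : ℂ) - x‖ := by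
    intro ζ hζ x hx
    by_contra hlt
    push Not at hlt
    refine hball (?_ : (ζ : ℂ) ∈ Metric.ball z δ) ⟨ζ, hζ, rfl⟩
    rw [mem_ball_iff_norm] at hx ⊢
    calc ‖(ζ : ℂ) - z‖ = ‖((ζ : ℂ) - x) + (x - z)‖ := by ring_nf
      _ ≤ ‖(ζ : ℂ) - x‖ + ‖x - z‖ := norm_add_le _ _
      _ < δ := by linarith
  have hae : ∀ᵐ ζ ∂ν, ζ ∈ E := by rw [ae_iff]; exact hν
  have hmeas : Measurable (fun ζ : Circle => (ζ : ℂ)) := continuous_circle_coe.measurable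
  have key := hasDerivAt_integral_of_dominated_loc_of_deriv_le (μ := ν)
    (F := fun (x : ℂ) (ζ : Circle) => ((ζ : ℂ) + x) / ((ζ : ℂ) - x))
    (F' := fun (x : ℂ) (ζ : Circle) => 2 * (ζ : ℂ) / ((ζ : ℂ) - x) ^ 2)
    (bound := fun _ => 2 / (δ / 2) ^ 2) (x₀ := z)
    (Metric.ball_mem_nhds z (half_pos hδ)) ?_ ?_ ?_ ?_ (integrable_const _) ?_
  · have := key.2.neg.cexp
    exact this
  · exact Eventually.of_forall fun x =>
      ((hmeas.add_const x).div (hmeas.sub_const x)).aestronglyMeasurable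
  · refine Integrable.of_bound
      ((hmeas.add_const z).div (hmeas.sub_const z)).aestronglyMeasurable
      ((1 + ‖z‖) / (δ / 2)) ?_
    filter_upwards [hae] with ζ hζ
    rw [norm_div]
    gcongr
    · exact (norm_add_le _ _).trans (by rw [Circle.norm_coe])
    · exact hdist ζ hζ z (Metric.mem_ball_self (half_pos hδ))
  · exact ((hmeas.const_mul 2).div ((hmeas.sub_const z).pow_const 2)).aestronglyMeasurable
  · filter_upwards [hae] with ζ hζ x hx
    rw [norm_div, norm_mul, norm_pow, Circle.norm_coe]
    simp only [Complex.norm_ofNat, mul_one]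
    gcongr
    exact hdist ζ hζ x hx
  · filter_upwards [hae] with ζ hζ x hx
    have hne : (ζ : ℂ) - x ≠ 0 := by
      rw [← norm_pos_iff]
      exact (half_pos hδ).trans_le (hdist ζ hζ x hx)
    have h := ((hasDerivAt_id x).const_add (ζ : ℂ)).div ((hasDerivAt_id x).const_sub (ζ : ℂ)) hne
    refine h.congr_deriv ?_
    simp only [id]
    ring

lemma continuousAt_deriv_singularInner {ν : Measure Circle} [IsFiniteMeasure ν] {E : Set Circle}
    (hE : IsClosed E) (hν : ν Eᶜ = 0) {z : ℂ} (hz : z ∉ (fun ζ : Circle => (ζ : ℂ)) '' E) :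
    ContinuousAt (deriv (singularInner ν)) z := by
  have hopen : IsOpen ((fun ζ : Circle => (ζ : ℂ)) '' E)ᶜ :=
    (hE.isCompact.image continuous_circle_coe).isClosed.isOpen_compl
  have hd : DifferentiableOn ℂ (singularInner ν) ((fun ζ : Circle => (ζ : ℂ)) '' E)ᶜ := fun x hx =>
    (hasDerivAt_singularInner hE hν hx).differentiableAt.differentiableWithinAt
  exact ((hd.deriv hopen).differentiableAt (hopen.mem_nhds hz)).continuousAt

lemma Circle.re_add_div_sub_eq_zero (ζ z : Circle) :
    (((ζ : ℂ) + z) / ((ζ : ℂ) - z)).re = 0 := by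
  have h1 := Circle.normSq_coe ζ
  have h2 := Circle.normSq_coe z
  rw [Complex.normSq_apply] at h1 h2
  rw [Complex.div_re, ← add_div]
  simp only [Complex.add_re, Complex.sub_re, Complex.add_im, Complex.sub_im]
  rw [show ((ζ : ℂ).re + (z : ℂ).re) * ((ζ : ℂ).re - (z : ℂ).re) +
    ((ζ : ℂ).im + (z : ℂ).im) * ((ζ : ℂ).im - (z : ℂ).im) = 0 by linear_combination h1 - h2]
  simp

/-- As conjugation is inversion on the circle, the phase of the kernel does not depend on `ζ`; this
is what rules out cancellation in the integral. For `ζ = z` both sides are `0` by division by zero.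
-/
lemma Circle.two_mul_div_sub_sq (ζ z : Circle) :
    2 * (ζ : ℂ) / ((ζ : ℂ) - z) ^ 2 = -(z : ℂ)⁻¹ * ((2 / ‖(ζ : ℂ) - z‖ ^ 2 : ℝ) : ℂ) := by
  by_cases h : ζ = z
  · simp [h]
  have hne : (ζ : ℂ) - z ≠ 0 := sub_ne_zero.2 fun hh => h (Subtype.ext hh)
  have hζ := Circle.coe_ne_zero ζ
  have hz := Circle.coe_ne_zero z
  have hnorm : ((‖(ζ : ℂ) - z‖ ^ 2 : ℝ) : ℂ) = ((ζ : ℂ) - z) * ((ζ : ℂ)⁻¹ - (z : ℂ)⁻¹) := by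
    rw [← Circle.coe_inv, ← Circle.coe_inv, Circle.coe_inv_eq_conj, Circle.coe_inv_eq_conj,
      ← map_sub, Complex.mul_conj, Complex.normSq_eq_norm_sq]
  have h3 : (ζ : ℂ)⁻¹ - (z : ℂ)⁻¹ = -(((ζ : ℂ) - z) / (ζ * z)) := by
    field_simp
    ring
  rw [Complex.ofReal_div, hnorm, h3]
  field_simp
  push_cast
  ring

lemma norm_deriv_singularInner_circle {ν : Measure Circle} [IsFiniteMeasure ν] {E : Set Circle}
    (hE : IsClosed E) (hν : ν Eᶜ = 0) {z : Circle} (hz : z ∉ E) :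
    ‖deriv (singularInner ν) z‖ = ∫ ζ : Circle, 2 / ‖(ζ : ℂ) - z‖ ^ 2 ∂ν := by
  have hz' : (z : ℂ) ∉ (fun ζ : Circle => (ζ : ℂ)) '' E := by
    rintro ⟨ζ, hζ, h⟩
    exact hz (Subtype.ext h ▸ hζ)
  have hre : (∫ ζ : Circle, ((ζ : ℂ) + z) / ((ζ : ℂ) - z) ∂ν).re = 0 := by
    by_cases hi : Integrable (fun ζ : Circle => ((ζ : ℂ) + z) / ((ζ : ℂ) - z)) ν
    · have := integral_re (𝕜 := ℂ) hi
      simp only [RCLike.re_eq_complex_re, Circle.re_add_div_sub_eq_zero, integral_zero] at this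
      exact this.symm
    · rw [integral_undef hi, Complex.zero_re]
  rw [(hasDerivAt_singularInner hE hν hz').deriv, norm_mul, singularInner, Complex.norm_exp,
    Complex.neg_re, hre, neg_zero, Real.exp_zero, one_mul, norm_neg]
  simp_rw [Circle.two_mul_div_sub_sq]
  rw [integral_const_mul, norm_mul, norm_neg, norm_inv, Circle.norm_coe, inv_one, one_mul,
    integral_complex_ofReal, Complex.norm_real, Real.norm_of_nonneg]
  exact integral_nonneg fun ζ => by positivity

lemma le_norm_deriv_singularInner {ν : Measure Circle} [IsFiniteMeasure ν] {E : Set Circle}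
    (hE : IsClosed E) (hν : ν Eᶜ = 0) {z : Circle} (hz : z ∉ E) {I : Set Circle} {d : ℝ}
    (hI : MeasurableSet I) (hd : ∀ ζ ∈ I, ‖(ζ : ℂ) - z‖ ≤ d) :
    2 * ν.real I / d ^ 2 ≤ ‖deriv (singularInner ν) z‖ := by
  rw [norm_deriv_singularInner_circle hE hν hz]
  have hopen : IsOpen Eᶜ := hE.isOpen_compl
  obtain ⟨δ, hδ, hball⟩ := Metric.isOpen_iff.1 hopen z hz
  have hdist : ∀ ζ ∈ E, δ ≤ ‖(ζ : ℂ) - z‖ := by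
    intro ζ hζ
    by_contra hlt
    push Not at hlt
    exact hball (show dist (ζ : ℂ) (z : ℂ) < δ by rwa [dist_eq_norm]) hζ
  have hae : ∀ᵐ ζ ∂ν, ζ ∈ E := by rw [ae_iff]; exact hν
  have hint : Integrable (fun ζ : Circle => 2 / ‖(ζ : ℂ) - z‖ ^ 2) ν := by
    refine Integrable.of_bound (C := 2 / δ ^ 2) ?_ ?_
    · exact (((continuous_circle_coe.measurable.sub_const (z : ℂ)).norm.pow_const
        2).const_div 2).aestronglyMeasurable
    · filter_upwards [hae] with ζ hζ
      rw [Real.norm_of_nonneg (by positivity)]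
      gcongr
      exact hdist ζ hζ
  calc 2 * ν.real I / d ^ 2 = ∫ ζ in I, 2 / d ^ 2 ∂ν := by
        rw [setIntegral_const, smul_eq_mul]; ring
    _ ≤ ∫ ζ in I, 2 / ‖(ζ : ℂ) - z‖ ^ 2 ∂ν := by
        refine integral_mono_ae (integrable_const _) hint.integrableOn ?_
        filter_upwards [ae_restrict_mem hI, ae_restrict_of_ae hae] with ζ hζ hζE
        have := hδ.trans_le (hdist ζ hζE)
        have := hd ζ hζ
        gcongr
    _ ≤ ∫ ζ, 2 / ‖(ζ : ℂ) - z‖ ^ 2 ∂ν :=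
        setIntegral_le_integral hint (Filter.Eventually.of_forall fun ζ => by
          simp only [Pi.zero_apply]; positivity)

open Filter Topology in
/-- If `S'_ν ∈ H^p`, then the boundary values of `S'_ν` off the closed carrier of `ν` satisfy a weak
type bound. -/
lemma DerivMemHardy.exists_bound {p : ℝ} (hp : 0 < p) {ν : Measure Circle} [IsFiniteMeasure ν]
    {E : Set Circle} (hE : IsClosed E) (hν : ν Eᶜ = 0) (h : DerivMemHardy p ν) :
    ∃ C : ℝ≥0, ∀ (G : Set ℝ) (B : ℝ), MeasurableSet G → G ⊆ Ioc (-Real.pi) Real.pi →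
      (∀ t ∈ G, Circle.exp t ∉ E) →
      (∀ t ∈ G, B ≤ ‖deriv (singularInner ν) (Circle.exp t)‖) →
      ENNReal.ofReal B ^ p * volume G ≤ C := by
  obtain ⟨-, C, hC⟩ := h
  refine ⟨C, fun G B hG hsub hGE hB => ?_⟩
  let r : ℕ → ℝ := fun n => 1 - (1 / ((n : ℝ) + 1))
  have hr : ∀ n, r n ∈ Ico (0 : ℝ) 1 := fun n => by
    have h1 : (0 : ℝ) < 1 / ((n : ℝ) + 1) := by positivity
    have h2 : 1 / ((n : ℝ) + 1) ≤ 1 := by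
      rw [div_le_one (by positivity)]; linarith [n.cast_nonneg (α := ℝ)]
    exact ⟨by simp only [r]; linarith, by simp only [r]; linarith⟩
  have hrlim : Tendsto r atTop (𝓝 1) := by
    simpa [r] using (tendsto_one_div_add_atTop_nhds_zero_nat (𝕜 := ℝ)).const_sub (1 : ℝ)
  have hlim : ∀ t ∈ G, Tendsto (fun n => ‖deriv (singularInner ν) (circleMap 0 (r n) t)‖ₑ ^ p)
      atTop (𝓝 (‖deriv (singularInner ν) (Circle.exp t)‖ₑ ^ p)) := by
    intro t ht
    have hz' : (Circle.exp t : ℂ) ∉ (fun ζ : Circle => (ζ : ℂ)) '' E := by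
      rintro ⟨ζ, hζ, h⟩
      exact hGE t ht (Subtype.ext h ▸ hζ)
    have hc := continuousAt_deriv_singularInner hE hν hz'
    have h1 : Tendsto (fun n => circleMap 0 (r n) t) atTop (𝓝 (Circle.exp t : ℂ)) := by
      have : Tendsto (fun n => ((r n : ℝ) : ℂ)) atTop (𝓝 ((1 : ℝ) : ℂ)) :=
        (Complex.continuous_ofReal.tendsto 1).comp hrlim
      have h2 := this.mul_const (Complex.exp (t * Complex.I))
      simpa [circleMap, Circle.coe_exp] using h2
    exact (ENNReal.continuous_rpow_const.tendsto _).comp ((hc.tendsto.comp h1).enorm)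
  have hmeas : ∀ n, Measurable fun t : ℝ =>
      ‖deriv (singularInner ν) (circleMap 0 (r n) t)‖ₑ ^ p := fun n =>
    (((measurable_deriv _).comp (continuous_circleMap 0 (r n)).measurable).enorm).pow_const p
  -- Fatou's lemma along `r n → 1`; the radial limits exist at every point of `G` because `S'_ν` is
  -- continuous off `E`.
  calc ENNReal.ofReal B ^ p * volume G = ∫⁻ _ in G, ENNReal.ofReal B ^ p := by
        rw [setLIntegral_const]
    _ ≤ ∫⁻ t in G, liminf
          (fun n => ‖deriv (singularInner ν) (circleMap 0 (r n) t)‖ₑ ^ p) atTop := by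
        refine setLIntegral_mono' hG fun t ht => ?_
        rw [(hlim t ht).liminf_eq, ← ofReal_norm]
        gcongr
        exact hB t ht
    _ ≤ liminf (fun n => ∫⁻ t in G,
          ‖deriv (singularInner ν) (circleMap 0 (r n) t)‖ₑ ^ p) atTop :=
        lintegral_liminf_le hmeas
    _ ≤ liminf (fun _ : ℕ => (C : ℝ≥0∞)) atTop := by
        refine liminf_le_liminf (Eventually.of_forall fun n => ?_)
        exact (lintegral_mono_set hsub).trans (hC _ (hr n))
    _ = C := liminf_const _

/-! ### Derivatives of singular inner functions carried by Cantor sets -/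

lemma Circle.norm_exp_sub_exp_le (s t : ℝ) :
    ‖(Circle.exp s : ℂ) - Circle.exp t‖ ≤ |s - t| := by
  have h : (Circle.exp s : ℂ) - Circle.exp t =
      Circle.exp t * (Complex.exp (Complex.I * (s - t : ℝ)) - 1) := by
    rw [mul_sub, mul_one, Circle.coe_exp, Circle.coe_exp, ← Complex.exp_add]
    congr 2
    push_cast
    ring
  rw [h, norm_mul, Circle.norm_coe, one_mul]
  exact Real.norm_exp_I_mul_ofReal_sub_one_le

lemma volume_cantorGap {A : ℝ} (n : ℕ) (w : Fin n → Bool) :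
    volume (cantorGap A n w) = ENNReal.ofReal (A⁻¹ ^ n * (1 - 2 * A⁻¹)) := by
  rw [cantorGap, Real.volume_Ioo]
  congr 1
  ring

lemma pairwiseDisjoint_cantorGap {A : ℝ} (hA : 2 < A) (n : ℕ) (s : Set (Fin n → Bool)) :
    s.PairwiseDisjoint (cantorGap A n) := by
  intro w _ w' _ hne
  rw [Function.onFun, Set.disjoint_left]
  exact fun t h h' => hne (eq_of_mem_cantorInterval hA (cantorGap_subset_interval hA n w h)
    (cantorGap_subset_interval hA n w' h'))

/-- The addresses of the arcs of generation `n` that carry at least half of the average mass. -/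
def heavyAddresses (A : ℝ) (ν : Measure Circle) (n : ℕ) : Finset (Fin n → Bool) := by
  classical
  exact Finset.univ.filter fun w => ν.real univ / 2 * 2⁻¹ ^ n ≤ ν.real (cantorArc A n w)

lemma mem_heavyAddresses {A : ℝ} {ν : Measure Circle} {n : ℕ} {w : Fin n → Bool} :
    w ∈ heavyAddresses A ν n ↔ ν.real univ / 2 * 2⁻¹ ^ n ≤ ν.real (cantorArc A n w) := by
  simp [heavyAddresses]

/-- The light arcs carry at most half of the mass of `ν` altogether, and each heavy arc carries at
most `2⁻ⁿ` because `ν ≤ μ`. -/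
lemma le_card_heavyAddresses {A : ℝ} {μ ν : Measure Circle} (hμ : IsCantorMeasure A μ)
    (hν : ν ≤ μ) (n : ℕ) : ν.real univ / 2 * 2 ^ n ≤ (heavyAddresses A ν n).card := by
  classical
  have := hμ.1
  have hfin : IsFiniteMeasure ν := isFiniteMeasure_of_le μ hν
  have hle : ∀ w, ν.real (cantorArc A n w) ≤
      (if w ∈ heavyAddresses A ν n then 2⁻¹ ^ n else 0) + ν.real univ / 2 * 2⁻¹ ^ n := by
    intro w
    split_ifs with hw
    · have h1 : ν.real (cantorArc A n w) ≤ μ.real (cantorArc A n w) :=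
        ENNReal.toReal_mono (measure_ne_top _ _) (hν _)
      have h2 : μ.real (cantorArc A n w) = 2⁻¹ ^ n := by
        rw [measureReal_def, hμ.2.2]
        simp
      have h3 : 0 ≤ ν.real univ / 2 * 2⁻¹ ^ n := by positivity
      linarith
    · rw [mem_heavyAddresses, not_le] at hw
      linarith
  have hnull : ν (circleCantorSet A)ᶜ = 0 := le_antisymm ((hν _).trans hμ.2.1.le) bot_le
  have htot : ν.real univ ≤ ∑ w, ν.real (cantorArc A n w) := by
    have h1 : ν univ ≤ ν (⋃ w, cantorArc A n w) := by
      rw [← measure_add_measure_compl (isClosed_circleCantorSet A).measurableSet, hnull, add_zero]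
      exact measure_mono (iInter_subset _ n)
    exact (ENNReal.toReal_mono (measure_ne_top _ _) h1).trans (measureReal_iUnion_fintype_le _)
  have hsum := htot.trans (Finset.sum_le_sum fun w _ => hle w)
  rw [Finset.sum_add_distrib, Finset.sum_ite_mem, Finset.univ_inter] at hsum
  simp only [Finset.sum_const, Finset.card_univ, Fintype.card_pi, Fintype.card_bool,
    Finset.prod_const, Fintype.card_fin, nsmul_eq_mul] at hsum
  push_cast at hsum
  have h2 : (2 : ℝ) ^ n * 2⁻¹ ^ n = 1 := by rw [← mul_pow]; norm_num
  have h3 : (2 : ℝ) ^ n * (ν.real univ / 2 * 2⁻¹ ^ n) = ν.real univ / 2 := by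
    linear_combination (ν.real univ / 2) * h2
  rw [h3] at hsum
  have h4 : ν.real univ / 2 ≤ (heavyAddresses A ν n).card * (2⁻¹ : ℝ) ^ n := by linarith
  calc ν.real univ / 2 * 2 ^ n ≤ (heavyAddresses A ν n).card * (2⁻¹ : ℝ) ^ n * 2 ^ n := by gcongr
    _ = (heavyAddresses A ν n).card := by linear_combination (heavyAddresses A ν n).card * h2

/-- Per generation, the total length of the gaps scales by `2/A` and the bound for `|S'|^p` by
`(A²/2)^p`. -/
lemma one_lt_growth_rate {A p : ℝ} (hA : 2 < A) (h : A ^ (1 - 2 * p) < 2 ^ (1 - p)) :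
    1 < 2 * A⁻¹ * (2⁻¹ * A ^ 2) ^ p := by
  have h0 : 0 < A := by linarith
  have e1 : (2⁻¹ * A ^ 2) ^ p = (2 ^ p)⁻¹ * A ^ (2 * p) := by
    rw [Real.mul_rpow (by norm_num) (by positivity), Real.inv_rpow (by norm_num),
      ← Real.rpow_natCast A 2, ← Real.rpow_mul h0.le]
    norm_num
  rw [Real.rpow_sub h0, Real.rpow_sub two_pos, Real.rpow_one, Real.rpow_one,
    div_lt_div_iff₀ (by positivity) (by positivity)] at h
  rw [e1, show 2 * A⁻¹ * ((2 ^ p)⁻¹ * A ^ (2 * p)) = 2 * A ^ (2 * p) / (A * 2 ^ p) by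
    field_simp, lt_div_iff₀ (by positivity), one_mul]
  exact h

theorem not_derivMemHardy_of_le_cantorMeasure {A p : ℝ} (hA : 2 < A) (hp : 0 < p)
    (h : A ^ (1 - 2 * p) < 2 ^ (1 - p)) {μ ν : Measure Circle} (hμ : IsCantorMeasure A μ)
    (hν0 : ν ≠ 0) (hν : ν ≤ μ) : ¬ DerivMemHardy p ν := by
  intro hmem
  have := hμ.1
  have hfin : IsFiniteMeasure ν := isFiniteMeasure_of_le μ hν
  have h0 : 0 < A := by linarith
  have hnull : ν (circleCantorSet A)ᶜ = 0 := le_antisymm ((hν _).trans hμ.2.1.le) bot_le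
  have hgap : 0 < 1 - 2 * A⁻¹ := by
    have := inv_pow_succ_lt_half hA 0
    simp at this
    linarith
  obtain ⟨C, hC⟩ := hmem.exists_bound hp (isClosed_circleCantorSet A) hnull
  set m := ν.real univ with hm
  have hmpos : 0 < m := by
    rw [hm, measureReal_def, ENNReal.toReal_pos_iff]
    exact ⟨pos_iff_ne_zero.2 (Measure.measure_univ_ne_zero.2 hν0), measure_lt_top _ _⟩
  have key : ∀ n : ℕ, m / 2 * (1 - 2 * A⁻¹) * m ^ p * (2 * A⁻¹ * (2⁻¹ * A ^ 2) ^ p) ^ n ≤ C := by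
    intro n
    -- The height is `2 · mass / distance²` with mass `(m/2) 2⁻ⁿ` and distance `A⁻ⁿ`, the length of
    -- the arc around the gap.
    have hb := hC (⋃ w ∈ heavyAddresses A ν n, cantorGap A n w) (m * (2⁻¹ * A ^ 2) ^ n)
      (Finset.measurableSet_biUnion _ fun _ _ => measurableSet_Ioo)
      (iUnion₂_subset fun w _ => (cantorGap_subset_interval hA n w).trans
        (cantorInterval_subset_Ioc_pi hA n w)) ?_ ?_
    · rw [measure_biUnion_finset (pairwiseDisjoint_cantorGap hA n _) fun _ _ => measurableSet_Ioo]
        at hb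
      simp only [volume_cantorGap, Finset.sum_const, nsmul_eq_mul] at hb
      rw [ENNReal.ofReal_rpow_of_nonneg (by positivity) hp.le, ← ENNReal.ofReal_natCast,
        ← ENNReal.ofReal_mul (by positivity), ← ENNReal.ofReal_mul (by positivity),
        ← ENNReal.ofReal_coe_nnreal, ENNReal.ofReal_le_ofReal_iff C.coe_nonneg] at hb
      refine le_trans (le_of_eq_of_le ?_ (mul_le_mul_of_nonneg_left
        (mul_le_mul_of_nonneg_right (le_card_heavyAddresses hμ hν n) (by positivity))
        (by positivity))) hb
      have e : ((2⁻¹ * A ^ 2) ^ n) ^ p = ((2⁻¹ * A ^ 2) ^ p) ^ n := by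
        rw [Real.rpow_pow_comm (by positivity)]
      rw [Real.mul_rpow hmpos.le (by positivity), e, mul_pow _ ((2⁻¹ * A ^ 2) ^ p), mul_pow]
      ring
    · intro t ht
      obtain ⟨w, -, hw⟩ := mem_iUnion₂.1 ht
      exact exp_cantorGap_notMem hA hw
    · intro t ht
      obtain ⟨w, hwW, hw⟩ := mem_iUnion₂.1 ht
      refine le_trans ?_ (le_norm_deriv_singularInner (isClosed_circleCantorSet A) hnull
        (exp_cantorGap_notMem hA hw) (isClosed_cantorArc A n w).measurableSet (d := A⁻¹ ^ n) ?_)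
      · have h1 := mem_heavyAddresses.1 hwW
        rw [le_div_iff₀ (by positivity)]
        calc m * (2⁻¹ * A ^ 2) ^ n * (A⁻¹ ^ n) ^ 2 = 2 * (m / 2 * 2⁻¹ ^ n) := by
              have : A ^ n * A⁻¹ ^ n = 1 := by rw [← mul_pow, mul_inv_cancel₀ h0.ne', one_pow]
              rw [mul_pow, ← pow_mul, mul_comm 2 n, pow_mul]
              linear_combination (m * 2⁻¹ ^ n * (A ^ n * A⁻¹ ^ n + 1)) * this
          _ ≤ _ := by gcongr
      · rintro _ ⟨s, hs, rfl⟩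
        have ht' := cantorGap_subset_interval hA n w hw
        refine (Circle.norm_exp_sub_exp_le s t).trans (abs_le.2 ⟨?_, ?_⟩)
        · linarith [hs.1, ht'.2]
        · linarith [hs.2, ht'.1]
  have hK : 0 < m / 2 * (1 - 2 * A⁻¹) * m ^ p := by positivity
  obtain ⟨n, hn⟩ := pow_unbounded_of_one_lt (C / (m / 2 * (1 - 2 * A⁻¹) * m ^ p))
    (one_lt_growth_rate hA h)
  rw [div_lt_iff₀ hK] at hn
  linarith [key n]

/-! ### Choice of the Cantor parameter and conclusion -/

lemma exists_cantor_parameter {p q : ℝ} (hp0 : 0 < p) (hp : p < 1 / 2) (hq : q < p / (1 - p)) :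
    ∃ A : ℝ, 2 < A ∧ 0 < 1 - q ∧ 2 < A ^ (1 - q) ∧ A ^ (1 - 2 * p) < 2 ^ (1 - p) := by
  have h1p : 0 < 1 - p := by linarith
  have h2p : 0 < 1 - 2 * p := by linarith
  have hq' : (1 - 2 * p) / (1 - p) < 1 - q := by
    rw [lt_div_iff₀ h1p] at hq
    rw [div_lt_iff₀ h1p]
    linarith
  have hα : 0 < 1 - q := lt_trans (by positivity) hq'
  -- Here `A = 2^s`: the bound `s > 1` gives `A > 2`, `s > 1/(1-q)` gives the Beurling--Carleson
  -- condition, and `s < (1-p)/(1-2p)` gives the divergence.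
  have hlt : max 1 (1 - q)⁻¹ < (1 - p) / (1 - 2 * p) := by
    refine max_lt ?_ ?_
    · rw [lt_div_iff₀ h2p]; linarith
    · rw [← inv_div]
      exact inv_strictAnti₀ (by positivity) hq'
  obtain ⟨s, hs1, hs2⟩ := exists_between hlt
  have hs0 : 1 < s := (le_max_left _ _).trans_lt hs1
  have hs3 : (1 - q)⁻¹ < s := (le_max_right _ _).trans_lt hs1
  have pow_gt : ∀ t : ℝ, 1 < t → (2 : ℝ) < 2 ^ t := fun t ht => by
    simpa using Real.rpow_lt_rpow_of_exponent_lt (one_lt_two (α := ℝ)) ht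
  refine ⟨2 ^ s, pow_gt s hs0, hα, ?_, ?_⟩
  · rw [← Real.rpow_mul zero_le_two]
    refine pow_gt _ ?_
    rwa [inv_lt_iff_one_lt_mul₀ hα] at hs3
  · rw [← Real.rpow_mul zero_le_two]
    exact Real.rpow_lt_rpow_of_exponent_lt one_lt_two ((lt_div_iff₀ h2p).1 hs2)

end
theorem mainTheorem11 (p : ℝ) (hp0 : 0 < p) (hp : p < 1 / 2) :
    (∀ q : ℝ, q < p / (1 - p) →
      ∃ (A : ℝ) (μ : Measure Circle), 2 < A ∧
        IsBeurlingCarleson (1 - q) (circleCantorSet A) ∧ IsCantorMeasure A μ ∧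
        ∀ ν : Measure Circle, ν ≠ 0 → ν ≤ μ → ¬ DerivMemHardy p ν) ∧
    (∃ μ : Measure Circle, IsFiniteMeasure μ ∧ μ ⟂ₘ arcLength ∧
      ConcentratedOnBeurlingCarleson (1 - p) μ ∧
      ¬ UpToCountableSums (DerivMemHardy p) μ) ∧
    (∀ q : ℝ,
      (∀ (E : Set Circle) (μ : Measure Circle), IsFiniteMeasure μ →
        IsBeurlingCarleson (1 - q) E → μ Eᶜ = 0 → DerivMemHardy p μ) →
      p / (1 - p) ≤ q) := by
  have ha : ∀ q : ℝ, q < p / (1 - p) →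
      ∃ (A : ℝ) (μ : Measure Circle), 2 < A ∧
        IsBeurlingCarleson (1 - q) (circleCantorSet A) ∧ IsCantorMeasure A μ ∧
        ∀ ν : Measure Circle, ν ≠ 0 → ν ≤ μ → ¬ DerivMemHardy p ν := by
    intro q hq
    obtain ⟨A, hA, hα, h1, h2⟩ := exists_cantor_parameter hp0 hp hq
    have hμ := isCantorMeasure_cantorMeasure hA
    exact ⟨A, cantorMeasure A, hA, isBeurlingCarleson_circleCantorSet hA hα h1, hμ,
      fun ν hν0 hν => not_derivMemHardy_of_le_cantorMeasure hA hp0 h2 hμ hν0 hν⟩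
  refine ⟨ha, ?_, fun q hq => ?_⟩
  · have hpq : p < p / (1 - p) := by
      rw [lt_div_iff₀ (by linarith)]
      nlinarith
    obtain ⟨A, μ, hA, hE, hμ, hν⟩ := ha p hpq
    have := hμ.1
    refine ⟨μ, inferInstance, ⟨(circleCantorSet A)ᶜ, hE.1.measurableSet.compl, hμ.2.1, ?_⟩,
      ⟨fun _ => circleCantorSet A, fun _ => hE, ?_⟩, ?_⟩
    · rw [compl_compl]
      exact hE.2.1
    · rw [iUnion_const]
      exact hμ.2.1
    · rintro ⟨m, hm, rfl⟩
      -- Each summand is dominated by the Cantor measure, so a nonzero one would contradict (a).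
      have hz : ∀ k, m k = 0 := fun k => by
        by_contra hk
        exact hν (m k) hk (Measure.le_sum m k) (hm k).2
      exact IsProbabilityMeasure.ne_zero (Measure.sum m)
        (Measure.sum_eq_zero.2 hz)
  · by_contra! hlt
    obtain ⟨A, μ, hA, hE, hμ, hν⟩ := ha q hlt
    have := hμ.1
    exact hν μ (IsProbabilityMeasure.ne_zero μ) le_rfl
      (hq (circleCantorSet A) μ inferInstance hE hμ.2.1)
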